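/- Let $K$ be a field, let $k\ge 1$ and $n\ge 3$ be integers, and let $S=K[x_1,\dots,x_n]$. Let $C_n^k$ be the $k$-th power of the cycle on $n$ vertices, i.e. the simple graph on $\{1,\dots,n\}$ in which two distinct vertices $i,j$ are adjacent if and only if $|j-i|\le k$ or $|j-i|\ge n-k$, and let $I(C_n^k)=(x_ix_j : \{i,j\}\in E(C_n^k))\subset S$ be its edge ideal. For a nonzero monomial ideal $I\subset S$, a Stanley decomposition of $I$ is a presentation of $I$ as a finite direct sum of $K$-vector spaces $I=\bigoplus_{i=1}^{s}v_iK[W_i]$, where each $v_i\in I$ is a nonzero $\mathbb{Z}^n$-homogeneous element (a nonzero scalar multiple of a monomial), $W_i\subseteq\{x_1,\dots,x_n\}$, and $v_iK[W_i]$ is the $K$-span of all products $v_iw$ with $w$ a monomial in the variables of $W_i$. The Stanley depth $\operatorname{sdepth}(I)$ is the maximum, over all Stanley decompositions of $I$, of $\min_i|W_i|$. Then $$\operatorname{sdepth}(I(C_n^k))\ \ge\ 2\qquad\text{if } n\le 2k+1,$$ $$\operatorname{sdepth}(I(C_n^k))\ \ge\ \left\lceil\frac{n-k}{2k+1}\right\rceil+1\qquad\text{if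 } n\ge 2k+2.$$ -/

import Mathlib

/-- The `k`-th power of the cycle on `n` vertices (for `n ≥ 3`): the simple graph in which two
distinct vertices `i`, `j` are adjacent if and only if `|j - i| ≤ k` or `|j - i| ≥ n - k`
(integer subtraction). Labelling the vertices by `0, …, n - 1` instead of `1, …, n` does not
change the differences. -/
def cyclePower (n k : ℕ) : SimpleGraph (Fin n) where
  Adj i j := i ≠ j ∧
    (|((j : ℕ) : ℤ) - ((i : ℕ) : ℤ)| ≤ (k : ℤ) ∨ (n : ℤ) - (k : ℤ) ≤ |((j : ℕ) : ℤ) - ((i : ℕ) : ℤ)|)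
  symm := ⟨fun i j h => ⟨h.1.symm, by rw [abs_sub_comm]; exact h.2⟩⟩
  loopless := ⟨fun _ h => h.1 rfl⟩

/-- The edge ideal of a simple graph on the vertex set `σ`, in the polynomial ring with one
variable for each vertex. -/
noncomputable def edgeIdeal {σ : Type*} (K : Type*) [Field K] (G : SimpleGraph σ) :
    Ideal (MvPolynomial σ K) :=
  Ideal.span {f | ∃ i j : σ, G.Adj i j ∧ f = MvPolynomial.X i * MvPolynomial.X j}

/-- The `K`-subspace `v K[W]` of the polynomial ring: the span of all products `v * w`, where `w` is
a monomial in the variables of `W`. -/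
noncomputable def stanleySpace {σ K : Type*} [Field K] (v : MvPolynomial σ K) (W : Finset σ) :
    Submodule K (MvPolynomial σ K) :=
  Submodule.span K {f | ∃ b : σ →₀ ℕ, b.support ⊆ W ∧ f = v * MvPolynomial.monomial b (1 : K)}

/-- A Stanley decomposition of a (monomial) ideal `I` of `K[x_i : i ∈ σ]`: a presentation of `I`, as
a `K`-vector space, as a finite direct sum of Stanley spaces `v K[W]`. Here `v ∈ I` is homogeneous
for the grading by exponent vectors (so `v` is a scalar multiple of a monomial), and `v K[W]` has
to be a free `K[W]`-module, which in a polynomial ring over a field means `v ≠ 0`. -/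
structure StanleyDecomposition {σ K : Type*} [Field K] (I : Ideal (MvPolynomial σ K)) where
  /-- the number of summands -/
  s : ℕ
  /-- the generators of the summands -/
  v : Fin s → MvPolynomial σ K
  /-- the sets of variables of the summands -/
  W : Fin s → Finset σ
  homogeneous : ∀ i, ∃ (a : σ →₀ ℕ) (c : K), v i = MvPolynomial.monomial a c
  mem : ∀ i, v i ∈ I
  free : ∀ i, v i ≠ 0
  independent : iSupIndep fun i => stanleySpace (v i) (W i)
  sum_eq : ⨆ i, stanleySpace (v i) (W i) = I.restrictScalars K

/-- The Stanley depth of a decomposition: the least cardinality of the sets `W i` (it is `⊤` only for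
the empty decomposition, which is one of the zero ideal). -/
noncomputable def StanleyDecomposition.depth {σ K : Type*} [Field K]
    {I : Ideal (MvPolynomial σ K)} (D : StanleyDecomposition I) : ℕ∞ :=
  ⨅ i, ((D.W i).card : ℕ∞)

/-- The Stanley depth of an ideal: the greatest Stanley depth of its Stanley decompositions. For a
nonzero ideal in finitely many variables all these depths are at most the number of variables, so
that the supremum is a maximum as soon as there is a decomposition. -/
noncomputable def stanleyDepth {σ K : Type*} [Field K] (I : Ideal (MvPolynomial σ K)) : ℕ∞ :=
  ⨆ D : StanleyDecomposition I, D.depth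

/-! A monomial lies in the edge ideal exactly when its support contains an edge, and the monomials
with support in `[A, B]` span `x_A K[B]`. Hence partitioning the edge-containing vertex sets into
intervals with all `|B| ≥ m` yields a Stanley decomposition of depth at least `m`.

Such partitions come from induction along a clique `Q` (`dependentSets_of_clique`), sorting sets `X`
by `X ∩ Q`. Two vertices in `Q` already give an edge, so the fibre is one interval. For `X ∩ Q =
{u}`, either `X` contains a neighbour of `u` outside `Q`, or the edge lies among the non-neighbours.
For `X ∩ Q = ∅` the clique is deleted. In a cycle power both deletions leave arcs, up to an isolated
vertex, and each extra `2k+1` vertices of an arc gains one in the bound. -/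

/-- A family of finite sets is the disjoint union of finitely many intervals `[A, B]` with
`m ≤ |B|`. -/
def IntervalPartitionable {σ : Type} (m : ℕ) (F : Set (Finset σ)) : Prop :=
  ∃ (ι : Type) (_ : Finite ι) (A B : ι → Finset σ),
    (∀ i, A i ⊆ B i ∧ m ≤ (B i).card) ∧
    (∀ i j X, X ∈ Set.Icc (A i) (B i) → X ∈ Set.Icc (A j) (B j) → i = j) ∧
    ∀ X, X ∈ F ↔ ∃ i, X ∈ Set.Icc (A i) (B i)

/-! ### Operations on interval partitions -/

namespace IntervalPartitionable

variable {σ : Type} {m : ℕ} {F : Set (Finset σ)}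

theorem empty : IntervalPartitionable m (∅ : Set (Finset σ)) :=
  ⟨Empty, inferInstance, Empty.elim, Empty.elim, fun i => i.elim, fun i => i.elim, by simp⟩

theorem Icc {A B : Finset σ} (h : m ≤ B.card) : IntervalPartitionable m (Set.Icc A B) := by
  by_cases hAB : A ⊆ B
  · exact ⟨Unit, inferInstance, fun _ => A, fun _ => B, fun _ => ⟨hAB, h⟩, fun _ _ _ _ _ => rfl,
      fun X => by simp⟩
  · rw [Set.Icc_eq_empty hAB]
    exact empty

/-- A family can be partitioned along the fibres of a function. -/
theorem of_fibers {κ : Type} [Finite κ] (f : Finset σ → κ)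
    (h : ∀ c, IntervalPartitionable m {X ∈ F | f X = c}) : IntervalPartitionable m F := by
  choose ι hι A B hAB hinj hmem using h
  refine ⟨Σ c, ι c, inferInstance, fun i => A i.1 i.2, fun i => B i.1 i.2, fun i => hAB _ _, ?_, ?_⟩
  · rintro ⟨c, i⟩ ⟨d, j⟩ X hi hj
    have hc : f X = c := ((hmem c X).2 ⟨i, hi⟩).2
    have hd : f X = d := ((hmem d X).2 ⟨j, hj⟩).2
    subst hc
    subst hd
    rw [hinj _ i j X hi hj]
  · intro X
    constructor
    · intro hX
      obtain ⟨i, hi⟩ := (hmem (f X) X).1 ⟨hX, rfl⟩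
      exact ⟨⟨_, i⟩, hi⟩
    · rintro ⟨⟨c, i⟩, hi⟩
      exact ((hmem c X).2 ⟨i, hi⟩).1

/-- A family can be partitioned along a property. -/
theorem of_split (p : Finset σ → Prop) (h₁ : IntervalPartitionable m {X ∈ F | p X})
    (h₂ : IntervalPartitionable m {X ∈ F | ¬ p X}) : IntervalPartitionable m F := by
  classical
  refine of_fibers (fun X => decide (p X)) fun c => ?_
  cases c
  · simpa using h₂
  · simpa using h₁

/-- The partition of a family into singletons. -/
theorem of_card_le [Finite σ] (h : ∀ X ∈ F, m ≤ X.card) : IntervalPartitionable m F := by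
  refine ⟨F, inferInstance, fun X => X, fun X => X, fun X => ⟨subset_rfl, h _ X.2⟩, ?_, ?_⟩
  · rintro ⟨A, hA⟩ ⟨B, hB⟩ X h₁ h₂
    simp only [Set.Icc_self, Set.mem_singleton_iff] at h₁ h₂
    exact Subtype.ext (h₁.symm.trans h₂)
  · intro X
    simp

variable [DecidableEq σ]

/-- Adding a fixed new element to all sets of a family. -/
theorem insert {u : σ} {G : Set (Finset σ)} (hF : IntervalPartitionable m F)
    (hu : ∀ X ∈ F, u ∉ X) (hG : ∀ X, X ∈ G ↔ u ∈ X ∧ X.erase u ∈ F) :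
    IntervalPartitionable (m + 1) G := by
  obtain ⟨ι, hι, A, B, hAB, hinj, hmem⟩ := hF
  have huB : ∀ i, u ∉ B i := fun i => hu _ ((hmem _).2 ⟨i, (hAB i).1, le_rfl⟩)
  have key : ∀ i X, X ∈ Set.Icc (Insert.insert u (A i)) (Insert.insert u (B i)) ↔
      u ∈ X ∧ X.erase u ∈ Set.Icc (A i) (B i) := by
    intro i X
    have huA : u ∉ A i := fun h => huB i ((hAB i).1 h)
    simp only [Set.mem_Icc, Finset.insert_subset_iff,
      Finset.subset_insert_iff, Finset.subset_erase]
    tauto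
  refine ⟨ι, hι, fun i => Insert.insert u (A i), fun i => Insert.insert u (B i), fun i => ⟨?_, ?_⟩,
    ?_, ?_⟩
  · exact Finset.insert_subset_insert _ (hAB i).1
  · rw [Finset.card_insert_of_notMem (huB i)]
    exact Nat.succ_le_succ (hAB i).2
  · intro i j X hi hj
    exact hinj i j _ ((key i X).1 hi).2 ((key j X).1 hj).2
  · intro X
    rw [hG, hmem]
    simp only [key]
    simp

/-- Adding a new element freely to the sets of a family. -/
theorem insert_free {u : σ} {G : Set (Finset σ)} (hF : IntervalPartitionable m F)
    (hu : ∀ X ∈ F, u ∉ X) (hG : ∀ X, X ∈ G ↔ X.erase u ∈ F) :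
    IntervalPartitionable (m + 1) G := by
  obtain ⟨ι, hι, A, B, hAB, hinj, hmem⟩ := hF
  have huB : ∀ i, u ∉ B i := fun i => hu _ ((hmem _).2 ⟨i, (hAB i).1, le_rfl⟩)
  have key : ∀ i X, X ∈ Set.Icc (A i) (Insert.insert u (B i)) ↔
      X.erase u ∈ Set.Icc (A i) (B i) := by
    intro i X
    have huA : u ∉ A i := fun h => huB i ((hAB i).1 h)
    simp only [Set.mem_Icc,
      Finset.subset_insert_iff, Finset.subset_erase]
    tauto
  refine ⟨ι, hι, A, fun i => Insert.insert u (B i), fun i => ⟨?_, ?_⟩, ?_, ?_⟩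
  · exact (hAB i).1.trans (Finset.subset_insert _ _)
  · rw [Finset.card_insert_of_notMem (huB i)]
    exact Nat.succ_le_succ (hAB i).2
  · intro i j X hi hj
    exact hinj i j _ ((key i X).1 hi) ((key j X).1 hj)
  · intro X
    rw [hG, hmem]
    simp only [key]

/-- The members of an interval that meet a given set. -/
theorem Icc_inter_nonempty (U M : Finset σ) :
    ∀ Z : Finset σ, M ⊆ Z → m + M.card ≤ Z.card + 1 →
      IntervalPartitionable m {X ∈ Set.Icc U Z | (X ∩ M).Nonempty} := by
  induction M using Finset.induction_on with
  | empty => intro Z _ _; simpa using empty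
  | insert w M hw ih =>
    intro Z hZ hcard
    rw [Finset.insert_subset_iff] at hZ
    rw [Finset.card_insert_of_notMem hw] at hcard
    -- Sets containing `w` meet `insert w M` automatically, so they fill `[U ∪ {w}, Z]`. The others
    -- live in `Z \ {w}`: one vertex is lost from `Z` and one from the set to be met, preserving the
    -- inequality.
    refine of_split (fun X => w ∈ X) ?_ ?_
    · convert Icc (m := m) (A := Insert.insert w U) (B := Z) (by omega) using 1
      ext X
      simp only [Set.mem_ofPred_eq, Set.mem_Icc, Finset.insert_subset_iff]
      constructor
      · tauto
      · rintro ⟨⟨h₁, h₂⟩, h₃⟩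
        exact ⟨⟨⟨h₂, h₃⟩, w, by simp [h₁]⟩, h₁⟩
    · convert ih (Z.erase w) (Finset.subset_erase.2 ⟨hZ.2, hw⟩) ?_ using 1
      · ext X
        simp only [Set.mem_ofPred_eq, Set.mem_Icc, Finset.subset_erase]
        constructor
        · rintro ⟨⟨⟨h₁, h₂⟩, h₃⟩, h₄⟩
          rw [Finset.inter_insert_of_notMem h₄] at h₃
          exact ⟨⟨h₁, h₂, h₄⟩, h₃⟩
        · rintro ⟨⟨h₁, h₂, h₄⟩, h₃⟩
          rw [Finset.inter_insert_of_notMem h₄]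
          exact ⟨⟨⟨h₁, h₂⟩, h₃⟩, h₄⟩
      · rw [Finset.card_erase_of_mem hZ.1]
        have := Finset.card_pos.2 ⟨w, hZ.1⟩
        omega

end IntervalPartitionable

/-! ### Sets containing an edge, and the clique recursion -/

/-- The subsets of `W` that contain an edge of `G`. -/
def dependentSets {σ : Type} (G : SimpleGraph σ) (W : Finset σ) : Set (Finset σ) :=
  {X | X ⊆ W ∧ ∃ i ∈ X, ∃ j ∈ X, G.Adj i j}

section Graph

variable {σ : Type} {G : SimpleGraph σ} {W : Finset σ} {m : ℕ}

theorem two_le_card_of_mem_dependentSets {X : Finset σ} (hX : X ∈ dependentSets G W) :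
    2 ≤ X.card := by
  obtain ⟨-, i, hi, j, hj, hij⟩ := hX
  exact Finset.one_lt_card.2 ⟨i, hi, j, hj, hij.ne⟩

variable [DecidableEq σ]

/-- An isolated vertex can be added freely to the sets which contain an edge. -/
theorem IntervalPartitionable.dependentSets_insert {v : σ}
    (h : IntervalPartitionable m (dependentSets G W)) (hv : v ∉ W) (hvW : ∀ w ∈ W, ¬ G.Adj v w) :
    IntervalPartitionable (m + 1) (dependentSets G (Insert.insert v W)) := by
  refine h.insert_free (fun X hX hvX => hv (hX.1 hvX)) fun X => ?_
  simp only [dependentSets, Set.mem_ofPred_eq, Finset.subset_insert_iff, Finset.mem_erase]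
  refine and_congr_right fun hX => ⟨?_, ?_⟩
  · rintro ⟨i, hi, j, hj, hij⟩
    have hi' : i ≠ v := by
      rintro rfl
      exact hvW j (hX (Finset.mem_erase.2 ⟨hij.ne', hj⟩)) hij
    have hj' : j ≠ v := by
      rintro rfl
      exact hvW i (hX (Finset.mem_erase.2 ⟨hij.ne, hi⟩)) hij.symm
    exact ⟨i, ⟨hi', hi⟩, j, ⟨hj', hj⟩, hij⟩
  · rintro ⟨i, hi, j, hj, hij⟩
    exact ⟨i, hi.2, j, hj.2, hij⟩

variable [Finite σ] [DecidableRel G.Adj]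

/-- Splitting the sets which contain an edge according to their intersection with a clique. -/
theorem IntervalPartitionable.dependentSets_of_clique {Q : Finset σ} (hQW : Q ⊆ W)
    (hQ : ∀ i ∈ Q, ∀ j ∈ Q, i ≠ j → G.Adj i j)
    (h₀ : IntervalPartitionable (m + 1) (dependentSets G (W \ Q)))
    (h₁ : ∀ u ∈ Q, IntervalPartitionable m (dependentSets G {w ∈ W \ Q | ¬ G.Adj u w}))
    (h₂ : ∀ u ∈ Q, m + {w ∈ W \ Q | G.Adj u w}.card ≤ (W \ Q).card + 1) :
    IntervalPartitionable (m + 1) (dependentSets G W) := by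
  -- The fibre over `T`, before requiring an edge, is a full interval.
  have hsub : ∀ X T : Finset σ, T ⊆ Q → (X ⊆ W ∧ X ∩ Q = T ↔ X ∈ Set.Icc T (T ∪ W \ Q)) := by
    intro X T hT
    simp only [Set.mem_Icc]
    constructor
    · rintro ⟨hX, rfl⟩
      refine ⟨Finset.inter_subset_left, fun x hx => ?_⟩
      by_cases hxQ : x ∈ Q <;> simp [hx, hxQ, hX hx]
    · rintro ⟨hTX, hX⟩
      refine ⟨fun x hx => ?_, ?_⟩
      · have := hX hx
        simp only [Finset.mem_union, Finset.mem_sdiff] at this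
        exact this.elim (fun h => hQW (hT h)) (fun h => h.1)
      · ext x
        have h1 := @hX x
        have h2 := @hT x
        have h3 := @hTX x
        simp only [Finset.mem_union, Finset.mem_sdiff, Finset.mem_inter] at *
        tauto
  refine .of_fibers (fun X => X ∩ Q) fun T => ?_
  by_cases hT : T ⊆ Q
  swap
  · convert IntervalPartitionable.empty
    ext X
    simp only [Set.mem_ofPred_eq, Set.mem_empty_iff_false, iff_false, not_and]
    rintro - rfl
    exact hT Finset.inter_subset_right
  have hdisj : Disjoint T (W \ Q) := Finset.disjoint_of_subset_left hT Finset.disjoint_sdiff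
  obtain hT0 | ⟨u, rfl⟩ | hT2 : T = ∅ ∨ (∃ u, T = {u}) ∨ 1 < T.card := by
    rw [← Finset.card_eq_one, ← Finset.card_eq_zero]
    omega
  · subst hT0
    convert h₀ using 1
    ext X
    simp only [dependentSets, Set.mem_ofPred_eq, Finset.subset_sdiff,
      Finset.disjoint_iff_inter_eq_empty]
    tauto
  · have huQ : u ∈ Q := by simpa using hT
    have huW : u ∉ W \ Q := by simpa using hdisj
    refine .of_split (fun X => (X ∩ {w ∈ W \ Q | G.Adj u w}).Nonempty) ?_ ?_
    · convert IntervalPartitionable.Icc_inter_nonempty (m := m + 1) {u} {w ∈ W \ Q | G.Adj u w}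
        ({u} ∪ W \ Q) ((Finset.filter_subset _ _).trans Finset.subset_union_right) ?_ using 1
      · ext X
        simp only [Set.mem_ofPred_eq, ← hsub X {u} hT]
        refine and_congr_left fun hX => ⟨fun h => ⟨h.1.1, h.2⟩, fun h => ⟨⟨h.1, ?_⟩, h.2⟩⟩
        obtain ⟨w, hw⟩ := hX
        simp only [Finset.mem_inter, Finset.mem_filter] at hw
        have : u ∈ X ∩ Q := by rw [h.2]; simp
        exact ⟨u, (Finset.mem_inter.1 this).1, w, hw.1, hw.2.2⟩
      · rw [Finset.card_union_of_disjoint hdisj, Finset.card_singleton]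
        have := h₂ u huQ
        omega
    -- No neighbour of `u` remains in `X`, so the edge avoids `u`; putting `u` back raises the bound
    -- from `m` to `m + 1`.
    · refine (h₁ u huQ).insert (u := u) ?_ fun X => ?_
      · intro X hX hu
        exact huW (Finset.mem_filter.1 (hX.1 hu)).1
      · have hne : ¬ (X ∩ {w ∈ W \ Q | G.Adj u w}).Nonempty ↔
            ∀ w ∈ X, w ∈ W \ Q → ¬ G.Adj u w := by
          simp only [Finset.Nonempty, Finset.mem_inter, Finset.mem_filter]
          push Not
          rfl
        simp only [Set.mem_ofPred_eq, hne, dependentSets]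
        constructor
        · rintro ⟨⟨⟨hX, i, hi, j, hj, hij⟩, hXQ⟩, hX'⟩
          have huX : u ∈ X := by
            have : u ∈ X ∩ Q := by rw [hXQ]; simp
            exact (Finset.mem_inter.1 this).1
          have hW : ∀ x ∈ X, x ≠ u → x ∈ W \ Q := by
            intro x hx hxu
            refine Finset.mem_sdiff.2 ⟨hX hx, fun hxQ => hxu ?_⟩
            have : x ∈ X ∩ Q := Finset.mem_inter.2 ⟨hx, hxQ⟩
            simpa [hXQ] using this
          refine ⟨huX, fun x hx => ?_, i, ?_, j, ?_, hij⟩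
          · rw [Finset.mem_erase] at hx
            have := hW x hx.2 hx.1
            exact Finset.mem_filter.2 ⟨this, hX' x hx.2 this⟩
          · refine Finset.mem_erase.2 ⟨?_, hi⟩
            rintro rfl
            exact hX' j hj (hW j hj hij.ne') hij
          · refine Finset.mem_erase.2 ⟨?_, hj⟩
            rintro rfl
            exact hX' i hi (hW i hi hij.ne) hij.symm
        · rintro ⟨huX, hX, i, hi, j, hj, hij⟩
          have hX' : ∀ x ∈ X, x ≠ u → x ∈ W \ Q ∧ ¬ G.Adj u x := fun x hx hxu =>
            Finset.mem_filter.1 (hX (Finset.mem_erase.2 ⟨hxu, hx⟩))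
          refine ⟨⟨⟨fun x hx => ?_, i, Finset.mem_of_mem_erase hi, j, Finset.mem_of_mem_erase hj,
            hij⟩, ?_⟩, fun w hw hwW => (hX' w hw ?_).2⟩
          · by_cases hxu : x = u
            · exact hxu ▸ hQW huQ
            · exact (Finset.mem_sdiff.1 (hX' x hx hxu).1).1
          · ext x
            rw [Finset.mem_inter, Finset.mem_singleton]
            constructor
            · rintro ⟨hx, hxQ⟩
              by_contra hxu
              exact (Finset.mem_sdiff.1 (hX' x hx hxu).1).2 hxQ
            · rintro rfl
              exact ⟨huX, huQ⟩
          · rintro rfl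
            exact huW hwW
  · obtain ⟨i, hi, j, hj, hij⟩ := Finset.one_lt_card.1 hT2
    convert IntervalPartitionable.Icc (m := m + 1) (A := T) (B := T ∪ W \ Q) ?_ using 1
    · ext X
      rw [← hsub X T hT]
      simp only [dependentSets, Set.mem_ofPred_eq]
      refine ⟨fun h => ⟨h.1.1, h.2⟩, ?_⟩
      rintro ⟨hX, rfl⟩
      exact ⟨⟨hX, i, (Finset.mem_inter.1 hi).1, j, (Finset.mem_inter.1 hj).1,
        hQ i (hT hi) j (hT hj) hij⟩, rfl⟩
    · rw [Finset.card_union_of_disjoint hdisj]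
      have := h₂ i (hT hi)
      omega

end Graph

/-! ### Arcs and the cycle power -/

section CyclePower

variable {n k : ℕ}

theorem cyclePower_adj_iff {i j : Fin n} : (cyclePower n k).Adj i j ↔
    (i : ℕ) ≠ j ∧ ((i : ℕ) ≤ j + k ∧ (j : ℕ) ≤ i + k ∨ n + i ≤ j + k ∨ n + j ≤ i + k) := by
  simp only [cyclePower, abs_le, le_abs, ne_eq, Fin.ext_iff]
  omega

/-- The vertices `i` with `a ≤ i < b`. -/
def finArc (n a b : ℕ) : Finset (Fin n) := {i | a ≤ (i : ℕ) ∧ (i : ℕ) < b}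

@[simp]
theorem mem_finArc {a b : ℕ} {i : Fin n} : i ∈ finArc n a b ↔ a ≤ (i : ℕ) ∧ (i : ℕ) < b := by
  simp [finArc]

theorem card_finArc {a b : ℕ} (hb : b ≤ n) : (finArc n a b).card = b - a := by
  rw [← Nat.card_Ico, ← Finset.card_map Fin.valEmbedding]
  congr 1
  ext x
  simp only [Finset.mem_map, mem_finArc, Fin.valEmbedding_apply, Finset.mem_Ico]
  exact ⟨by rintro ⟨i, hi, rfl⟩; exact hi, fun hx => ⟨⟨x, by omega⟩, hx, rfl⟩⟩

-- The condition `b + k ≤ n + a` excludes edges that wrap around the cycle. The clique is `a+1, …,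
-- a+k`, skipping the end `a`. Deleting it isolates `a`, which is added back freely and supplies the
-- missing unit. For `u` in the clique, `a` is a neighbour, so the non-neighbours form the arc from
-- `u+k+1`, at most `2k+1` vertices shorter.
open Classical in
theorem intervalPartitionable_finArc (t : ℕ) : ∀ a b : ℕ, b ≤ n → b + k ≤ n + a →
    (t = 0 ∨ a + t * (2 * k + 1) < b) →
    IntervalPartitionable (t + 2) (dependentSets (cyclePower n k) (finArc n a b)) := by
  induction t with
  | zero =>
    intro a b _ _ _
    exact .of_card_le fun X hX => two_le_card_of_mem_dependentSets hX
  | succ t ih =>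
    intro a b hb hab ht
    have hlen : a + t * (2 * k + 1) + (2 * k + 1) < b := by
      rcases ht with h | h
      · omega
      · linarith
    have ht' : t ≤ t * (2 * k + 1) := Nat.le_mul_of_pos_right _ (by omega)
    set s := t * (2 * k + 1)
    let v : Fin n := ⟨a, by omega⟩
    have hQ : finArc n (a + 1) (a + k + 1) ⊆ finArc n a b := by
      intro i
      simp only [mem_finArc]
      omega
    have hdiff : finArc n a b \ finArc n (a + 1) (a + k + 1) =
        insert v (finArc n (a + k + 1) b) := by
      ext i
      simp only [Finset.mem_sdiff, mem_finArc, Finset.mem_insert, Fin.ext_iff, v]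
      omega
    have hv : v ∉ finArc n (a + k + 1) b := by
      simp only [mem_finArc, v]
      omega
    refine IntervalPartitionable.dependentSets_of_clique (m := t + 2) hQ ?_ ?_ ?_ ?_
    · intro i hi j hj hij
      rw [mem_finArc] at hi hj
      rw [cyclePower_adj_iff]
      rw [Ne, Fin.ext_iff] at hij
      omega
    · rw [hdiff]
      refine (ih (a + k + 1) b hb (by omega) (by right; omega)).dependentSets_insert hv ?_
      intro w hw
      rw [mem_finArc] at hw
      rw [cyclePower_adj_iff]
      simp only [v]
      omega
    · intro u hu
      rw [mem_finArc] at hu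
      convert ih (u + k + 1) b hb (by omega) (by right; omega) using 2
      ext w
      simp only [Finset.mem_filter, Finset.mem_sdiff, mem_finArc, cyclePower_adj_iff]
      omega
    · intro u hu
      rw [mem_finArc] at hu
      have hsub : {w ∈ finArc n a b \ finArc n (a + 1) (a + k + 1) | (cyclePower n k).Adj u w} ⊆
          insert v (finArc n (a + k + 1) (a + 2 * k + 1)) := by
        intro w
        simp only [Finset.mem_filter, Finset.mem_sdiff, mem_finArc, cyclePower_adj_iff,
          Finset.mem_insert, Fin.ext_iff, v]
        omega
      have h₁ := (Finset.card_le_card hsub).trans (Finset.card_insert_le _ _)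
      rw [card_finArc (by omega)] at h₁
      rw [hdiff, Finset.card_insert_of_notMem hv, card_finArc hb, ← hdiff]
      omega

-- The clique of the first `k` vertices cuts the cycle open into an arc of `n - k` vertices, whence
-- the `n - k` in the bound.
open Classical in
theorem intervalPartitionable_cyclePower {t : ℕ} (hn : 2 * k + 2 ≤ n)
    (ht : t * (2 * k + 1) + k < n) :
    IntervalPartitionable (t + 2) (dependentSets (cyclePower n k) Finset.univ) := by
  rcases t with - | t
  · exact .of_card_le fun X hX => two_le_card_of_mem_dependentSets hX
  have hlen : t * (2 * k + 1) + (2 * k + 1) + k < n := by linarith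
  have ht' : t = 0 ∨ t + 2 * k ≤ t * (2 * k + 1) := by
    rcases t with - | t
    · exact Or.inl rfl
    · right; nlinarith [Nat.zero_le (t * k)]
  refine IntervalPartitionable.dependentSets_of_clique (m := t + 2) (Q := finArc n 0 k)
    (Finset.subset_univ _) ?_ ?_ ?_ ?_
  · intro i hi j hj hij
    rw [mem_finArc] at hi hj
    rw [cyclePower_adj_iff]
    rw [Ne, Fin.ext_iff] at hij
    omega
  · convert intervalPartitionable_finArc (n := n) (k := k) (t + 1) k n le_rfl (by omega)
      (by right; linarith) using 2
    ext i
    simp only [Finset.mem_sdiff, Finset.mem_univ, true_and, mem_finArc]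
    omega
  -- The closed neighbourhood of `u` contains the clique and has `2k+1` vertices; its complement is
  -- an arc of `n - 2k - 1` vertices.
  · intro u hu
    rw [mem_finArc] at hu
    convert intervalPartitionable_finArc (n := n) (k := k) t (u + k + 1) (n + u - k) (by omega)
      (by omega) (by right; omega) using 2
    ext w
    simp only [Finset.mem_filter, Finset.mem_sdiff, Finset.mem_univ, true_and, mem_finArc,
      cyclePower_adj_iff]
    omega
  · intro u hu
    rw [mem_finArc] at hu
    have hsub : {w ∈ Finset.univ \ finArc n 0 k | (cyclePower n k).Adj u w} ⊆
        finArc n k (u + k + 1) ∪ finArc n (n + u - k) n := by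
      intro w
      simp only [Finset.mem_filter, Finset.mem_sdiff, Finset.mem_univ, true_and, mem_finArc,
        cyclePower_adj_iff, Finset.mem_union]
      omega
    have h₁ := (Finset.card_le_card hsub).trans (Finset.card_union_le _ _)
    rw [card_finArc (by omega), card_finArc le_rfl] at h₁
    have hdiff : Finset.univ \ finArc n 0 k = finArc n k n := by
      ext i
      simp only [Finset.mem_sdiff, Finset.mem_univ, true_and, mem_finArc]
      omega
    have h₂ : (Finset.univ \ finArc n 0 k).card = n - k := by rw [hdiff, card_finArc le_rfl]
    omega

end CyclePower

/-! ### From interval partitions to Stanley decompositions -/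

section StanleyDepth

variable {σ : Type} {K : Type*} [Field K]

open MvPolynomial

theorem edgeIdeal_restrictScalars (G : SimpleGraph σ) [Fintype σ] :
    (edgeIdeal K G).restrictScalars K =
      restrictSupport K {c : σ →₀ ℕ | c.support ∈ dependentSets G Finset.univ} := by
  classical
  have hspan : edgeIdeal K G = Ideal.span ((fun s => monomial s (1 : K)) ''
      {c : σ →₀ ℕ | ∃ i j, G.Adj i j ∧ c = Finsupp.single i 1 + Finsupp.single j 1}) := by
    unfold edgeIdeal
    congr 1
    ext f
    constructor
    · rintro ⟨i, j, hij, rfl⟩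
      exact ⟨_, ⟨i, j, hij, rfl⟩, by simp [X, monomial_mul]⟩
    · rintro ⟨_, ⟨i, j, hij, rfl⟩, rfl⟩
      exact ⟨i, j, hij, by simp [X, monomial_mul]⟩
  ext f
  rw [Submodule.restrictScalars_mem, hspan, mem_ideal_span_monomial_image,
    mem_restrictSupport_iff]
  refine forall₂_congr fun c _ => ?_
  constructor
  · rintro ⟨_, ⟨i, j, hij, rfl⟩, hle⟩
    refine ⟨Finset.subset_univ _, i, ?_, j, ?_, hij⟩
    · have := hle i
      simp only [Finsupp.add_apply, Finsupp.single_eq_same] at this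
      rw [Finsupp.mem_support_iff]
      omega
    · have := hle j
      simp only [Finsupp.add_apply, Finsupp.single_eq_same] at this
      rw [Finsupp.mem_support_iff]
      omega
  · rintro ⟨-, i, hi, j, hj, hij⟩
    refine ⟨_, ⟨i, j, hij, rfl⟩, fun x => ?_⟩
    rw [Finsupp.mem_support_iff] at hi hj
    -- Since `i ≠ j`, the exponents of the generator are at most 1, so divisibility depends only on
    -- the support.
    have hne := hij.ne
    simp only [Finsupp.add_apply, Finsupp.single_apply]
    split_ifs with h₁ h₂ h₂
    · exact absurd (h₁.trans h₂.symm) hne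
    · subst h₁; omega
    · subst h₂; omega
    · simp

/-- The Stanley space of a squarefree monomial with support `A ⊆ B` in the variables `B` is spanned
by the monomials whose support lies between `A` and `B`. -/
theorem stanleySpace_indicator {A B : Finset σ} (hAB : A ⊆ B) :
    stanleySpace (monomial (Finsupp.indicator A fun _ _ => 1) (1 : K)) B =
      restrictSupport K {c : σ →₀ ℕ | c.support ∈ Set.Icc A B} := by
  classical
  rw [restrictSupport_eq_span, stanleySpace]
  congr 1
  ext f
  simp only [Set.mem_ofPred_eq, Set.mem_image, monomial_mul, mul_one, Set.mem_Icc]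
  constructor
  · rintro ⟨b, hb, rfl⟩
    refine ⟨_, ⟨fun x hx => ?_, fun x hx => ?_⟩, rfl⟩
    · simp [Finsupp.indicator_apply, hx]
    · by_contra hxB
      have hxA : x ∉ A := fun h => hxB (hAB h)
      have hxb : b x = 0 := Finsupp.notMem_support_iff.1 fun h => hxB (hb h)
      simp [Finsupp.indicator_apply, hxA, hxb] at hx
  · rintro ⟨c, ⟨hA, hB⟩, rfl⟩
    refine ⟨c - Finsupp.indicator A fun _ _ => 1, fun x hx => hB ?_, ?_⟩
    · rw [Finsupp.mem_support_iff, Finsupp.tsub_apply] at hx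
      rw [Finsupp.mem_support_iff]
      omega
    · rw [add_tsub_cancel_of_le]
      intro x
      rw [Finsupp.indicator_apply]
      split_ifs with hx
      · exact Nat.one_le_iff_ne_zero.2 (Finsupp.mem_support_iff.1 (hA hx))
      · exact Nat.zero_le _

/-- A squarefree partition into intervals `[A, B]` with `m ≤ |B|` bounds the Stanley depth. -/
theorem le_stanleyDepth_of_intervalPartitionable {I : Ideal (MvPolynomial σ K)} {m : ℕ}
    {F : Set (Finset σ)}
    (hI : I.restrictScalars K = restrictSupport K {c : σ →₀ ℕ | c.support ∈ F})
    (hF : IntervalPartitionable m F) : (m : ℕ∞) ≤ stanleyDepth I := by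
  classical
  obtain ⟨ι, hι, A, B, hAB, hinj, hmem⟩ := hF
  obtain ⟨s, ⟨e⟩⟩ := Finite.exists_equiv_fin ι
  let S : Fin s → Set (σ →₀ ℕ) := fun i => {c | c.support ∈ Set.Icc (A (e.symm i)) (B (e.symm i))}
  have hS : ∀ i, stanleySpace (monomial (Finsupp.indicator (A (e.symm i)) fun _ _ => 1) (1 : K))
      (B (e.symm i)) = restrictSupport K (S i) := fun i => stanleySpace_indicator (hAB _).1
  -- Sums of monomial subspaces correspond to unions of exponent sets, so directness reduces to
  -- disjointness of the intervals.
  have hsup : ∀ p : Fin s → Prop, ⨆ (i) (_ : p i), restrictSupport K (S i) =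
      restrictSupport K (⋃ (i) (_ : p i), S i) := by
    intro p
    simp only [restrictSupport_eq_span, Set.image_iUnion, Submodule.span_iUnion]
  let D : StanleyDecomposition I :=
    { s := s
      v := fun i => monomial (Finsupp.indicator (A (e.symm i)) fun _ _ => 1) 1
      W := fun i => B (e.symm i)
      homogeneous := fun i => ⟨_, _, rfl⟩
      mem := fun i => by
        rw [← Submodule.restrictScalars_mem K, hI, monomial_mem_restrictSupport]
        left
        have hsupp : (Finsupp.indicator (A (e.symm i)) fun _ _ => 1).support = A (e.symm i) := by
          ext x
          simp [Finsupp.indicator_apply]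
        simp only [Set.mem_ofPred_eq, hsupp, hmem]
        exact ⟨e.symm i, le_rfl, (hAB _).1⟩
      free := fun i => by simp
      independent := by
        intro i
        simp only [hS]
        rw [hsup, Submodule.disjoint_def]
        intro f hf hf'
        rw [mem_restrictSupport_iff] at hf hf'
        rw [← support_eq_empty, Finset.eq_empty_iff_forall_notMem]
        intro c hc
        obtain ⟨j, hj, hcj⟩ := Set.mem_iUnion₂.1 (hf' hc)
        exact hj (e.symm.injective (hinj _ _ _ hcj (hf hc)))
      sum_eq := by
        simp only [hS]
        have := hsup fun _ => True
        simp only [iSup_true, Set.iUnion_true] at this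
        rw [this, hI]
        congr 1
        ext c
        simp only [Set.mem_iUnion, Set.mem_ofPred_eq, hmem, S]
        exact (e.symm.surjective.exists (p := fun i => c.support ∈ Set.Icc (A i) (B i))).symm }
  refine le_trans (le_iInf fun i => ?_) (le_iSup StanleyDecomposition.depth D)
  exact_mod_cast (hAB (e.symm i)).2

end StanleyDepth

theorem theorem5p4 {K : Type*} [Field K] (n k : ℕ) (hn : 3 ≤ n) (hk : 1 ≤ k) :
    (n ≤ 2 * k + 1 → 2 ≤ stanleyDepth (edgeIdeal K (cyclePower n k))) ∧
    (2 * k + 2 ≤ n →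
      ((⌈((n : ℚ) - (k : ℚ)) / (2 * (k : ℚ) + 1)⌉₊ + 1 : ℕ) : ℕ∞) ≤
        stanleyDepth (edgeIdeal K (cyclePower n k))) := by
  refine ⟨fun _ => ?_, fun hnk => ?_⟩
  · exact le_stanleyDepth_of_intervalPartitionable (m := 2) (edgeIdeal_restrictScalars _)
      (.of_card_le fun X hX => two_le_card_of_mem_dependentSets hX)
  · have hpos : (0 : ℚ) < 2 * (k : ℚ) + 1 := by positivity
    have hkn : (k : ℚ) < n := by exact_mod_cast (by omega : k < n)
    -- With the ceiling equal to `t + 1`, the target is `t + 2`, and `t` lies strictly below the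
    -- quotient: `t(2k+1) + k < n`.
    obtain ⟨t, ht⟩ := Nat.exists_eq_succ_of_ne_zero
      (Nat.ceil_pos.2 (div_pos (sub_pos.2 hkn) hpos)).ne'
    have hlt : (t : ℚ) < ((n : ℚ) - k) / (2 * k + 1) := Nat.lt_ceil.1 (by omega)
    rw [lt_div_iff₀ hpos, lt_sub_iff_add_lt] at hlt
    rw [ht]
    exact le_stanleyDepth_of_intervalPartitionable (edgeIdeal_restrictScalars _)
      (intervalPartitionable_cyclePower hnk (by exact_mod_cast hlt))
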